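/- Write points of the unit sphere $\mathbb S^2\subset\mathbb R^3$ as $\Omega=(\sqrt{1-\mu^2}\cos\varphi,\sqrt{1-\mu^2}\sin\varphi,\mu)$ with $\mu\in[-1,1]$, $\varphi\in[0,2\pi)$, and let $L^2(\mathbb S^2)$ be the space of real-valued functions that are square integrable with respect to the surface measure. Let $P_l(\mu)=\frac{1}{2^l l!}\frac{d^l}{d\mu^l}(\mu^2-1)^l$ be the Legendre polynomials and let $P_l^m(\mu)=\varepsilon^m(1-\mu^2)^{m/2}\frac{d^m}{d\mu^m}P_l(\mu)$ be the associated Legendre functions, where the fixed sign $\varepsilon\in\{1,-1\}$ is either of the two usual conventions (without or with the Condon–Shortley phase). Let $$N_{l,m}:=\sqrt{\frac{2l+1}{4\pi}\frac{(l-m)!}{(l+m)!}},\qquad l\ge 0,\ 0\le m\le l,$$ and define, for $l\ge 0$, $\Phi_l^0(\mu,\varphi):=N_{l,0}P_l(\mu)$ and, for $1\le m\le l$, $$\Phi_l^{m,\mathrm c}(\mu,\varphi):=\sqrt2\,N_{l,m}P_l^m(\mu)\cos(m\varphi),\qquad \Phi_l^{m,\mathrm s}(\mu,\varphi):=\sqrt2\,N_{l,m}P_l^m(\mu)\sin(m\varphi).$$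 Then, for either choice of $\varepsilon$, the family $\{\Phi_l^0,\ \Phi_l^{m,\mathrm c},\ \Phi_l^{m,\mathrm s} : l\ge 0,\ 1\le m\le l\}$ is an orthonormal basis of $L^2(\mathbb S^2)$: it is orthonormal and its linear span is dense. -/

import Mathlib

open MeasureTheory

noncomputable section

namespace RealSphHarm

/-- The unit sphere `𝕊²` of Euclidean three-space. -/
abbrev S2 : Type := Metric.sphere (0 : EuclideanSpace ℝ (Fin 3)) 1

/-- The surface measure of `𝕊²` (of total mass `4π`). -/
abbrev surfaceMeasure : Measure S2 :=
  (volume : Measure (EuclideanSpace ℝ (Fin 3))).toSphere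

/-- The coordinate `μ = Ω_z ∈ [-1, 1]` of a point `Ω` of the sphere. -/
def height (Ω : S2) : ℝ := Ω.1 2

/-- The azimuth `φ ∈ [0, 2π)` of a point `Ω` of the sphere, that is, the angle of `(Ω_x, Ω_y)`
(with the value `0` at the two poles). -/
def azimuth (Ω : S2) : ℝ :=
  toIcoMod Real.two_pi_pos 0 (Complex.arg ⟨Ω.1 0, Ω.1 1⟩)

/-- `height` and `azimuth` are the spherical coordinates: the first lies in `[-1, 1]`, the second
in `[0, 2π)`, and `Ω = (√(1 - μ²) cos φ, √(1 - μ²) sin φ, μ)`. -/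
theorem spherical_coordinates (Ω : S2) :
    height Ω ∈ Set.Icc (-1 : ℝ) 1 ∧ azimuth Ω ∈ Set.Ico 0 (2 * Real.pi) ∧
      Ω.1 = !₂[√(1 - height Ω ^ 2) * Real.cos (azimuth Ω),
        √(1 - height Ω ^ 2) * Real.sin (azimuth Ω), height Ω] := by
  have h : Ω.1 0 ^ 2 + Ω.1 1 ^ 2 + Ω.1 2 ^ 2 = 1 := by
    have h1 : ‖Ω.1‖ = 1 := by simp
    rw [EuclideanSpace.norm_eq, Real.sqrt_eq_one] at h1
    simpa [Fin.sum_univ_three] using h1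
  have hn : √(1 - height Ω ^ 2) = ‖(⟨Ω.1 0, Ω.1 1⟩ : ℂ)‖ := by
    rw [Complex.norm_def, Complex.normSq_mk]
    congr 1
    unfold height
    linarith
  have hc : Real.cos (azimuth Ω) = Real.cos (Complex.arg ⟨Ω.1 0, Ω.1 1⟩) := by
    unfold azimuth toIcoMod
    rw [zsmul_eq_mul, Real.cos_sub_int_mul_two_pi]
  have hs : Real.sin (azimuth Ω) = Real.sin (Complex.arg ⟨Ω.1 0, Ω.1 1⟩) := by
    unfold azimuth toIcoMod
    rw [zsmul_eq_mul, Real.sin_sub_int_mul_two_pi]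
  refine ⟨?_, ?_, ?_⟩
  · unfold height
    constructor <;> nlinarith [sq_nonneg (Ω.1 0), sq_nonneg (Ω.1 1)]
  · simpa [azimuth] using toIcoMod_mem_Ico Real.two_pi_pos 0 (Complex.arg ⟨Ω.1 0, Ω.1 1⟩)
  · rw [hc, hs, hn, Complex.norm_mul_cos_arg, Complex.norm_mul_sin_arg]
    ext i
    fin_cases i <;> simp [height]

/-- The Legendre polynomial `P_l = (1 / (2^l l!)) (d/dx)^l (x² - 1)^l`. -/
def legendre (l : ℕ) : Polynomial ℝ :=
  Polynomial.C (1 / (2 ^ l * (l.factorial : ℝ))) *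
    (Polynomial.derivative^[l] ((Polynomial.X ^ 2 - 1) ^ l))

/-- The associated Legendre function `P_l^m(μ) = ε^m (1 - μ²)^{m/2} P_l^{(m)}(μ)` on `[-1, 1]`.
The sign `ε = ±1` selects one of the two usual conventions: `ε = -1` includes the
Condon–Shortley phase `(-1)^m`, and `ε = 1` omits it. -/
def assocLegendre (ε : ℤˣ) (l m : ℕ) (μ : ℝ) : ℝ :=
  ((ε : ℤ) : ℝ) ^ m * √(1 - μ ^ 2) ^ m *
    (Polynomial.derivative^[m] (legendre l)).eval μ

/-- The constant `N_{l,m} = √((2l+1)/(4π) · (l-m)!/(l+m)!)`, for `m ≤ l`. -/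
def normConst (l m : ℕ) : ℝ :=
  √((2 * (l : ℝ) + 1) / (4 * Real.pi) * (((l - m).factorial : ℝ) / ((l + m).factorial : ℝ)))

/-- The indices of the family: `(l, 0)` with `l ≥ 0`, and, for `1 ≤ m ≤ l`, the pair `(l, m)`
once with a cosine and once with a sine. -/
inductive Index : Type
  | zonal (l : ℕ) : Index
  | cosine (l m : ℕ) (hm : 1 ≤ m) (hml : m ≤ l) : Index
  | sine (l m : ℕ) (hm : 1 ≤ m) (hml : m ≤ l) : Index

/-- The real spherical harmonics `Φ_l^0`, `Φ_l^{m,c}`, `Φ_l^{m,s}` as functions of `(μ, φ)`. -/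
def Phi (ε : ℤˣ) : Index → ℝ → ℝ → ℝ
  | .zonal l, μ, _ => normConst l 0 * (legendre l).eval μ
  | .cosine l m _ _, μ, φ => √2 * normConst l m * assocLegendre ε l m μ * Real.cos (m * φ)
  | .sine l m _ _, μ, φ => √2 * normConst l m * assocLegendre ε l m μ * Real.sin (m * φ)

end RealSphHarm

end

/-! ### Surface measure in spherical coordinates -/

noncomputable section

namespace RealSphHarm

open Real Set Metric
open scoped ENNReal Pointwise

/-! Orthonormality: the surface measure is the image of `sin θ dθ dφ` (`surfaceMeasure_eq_map`), so
the scalar product of two harmonics is a polar integral times an azimuthal one. The azimuthal factor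
settles distinct orders, and cosine against sine. For equal orders `x = cos θ` turns the polar
factor into the integral of `(1 - x²)^m P_l^(m) P_k^(m)` over `[-1, 1]`; `polyIntegral_order`
reduces it to `m = 0`, and Rodrigues' formula with repeated integration by parts evaluates it.

Completeness: with `w = x + iy`, the harmonics are, up to nonzero constants, `P_l^(m)(z) Re w^m` and
`P_l^(m)(z) Im w^m`. For fixed `m` the derivatives `P_l^(m)` span all polynomials, so the span of
the harmonics contains every `p(z) Re w^m` and `p(z) Im w^m`. It is therefore stable under
multiplication by `x`, `y` and `z`, contains all polynomial functions, and is uniformly dense by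
Stone–Weierstrass. Uniform density gives density in `L²`. -/

theorem lintegral_euclideanSpace_three (f : EuclideanSpace ℝ (Fin 3) → ℝ≥0∞) (hf : Measurable f) :
    ∫⁻ x, f x = ∫⁻ z : ℝ, ∫⁻ p : ℝ × ℝ, f !₂[p.1, p.2, z] := by
  rw [← (PiLp.volume_preserving_toLp (Fin 3)).lintegral_comp hf,
    ← (volume_preserving_piFinSuccAbove (fun _ : Fin 3 => ℝ) 2).symm.lintegral_comp (by fun_prop),
    Measure.volume_eq_prod, lintegral_prod _ (by fun_prop)]
  congr 1 with z
  rw [← (volume_preserving_finTwoArrow ℝ).symm.lintegral_comp (by fun_prop)]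
  congr 1 with p
  congr 2
  ext i
  fin_cases i <;> rfl

/-- Integration over the space in spherical coordinates. -/
theorem lintegral_spherical (f : EuclideanSpace ℝ (Fin 3) → ℝ≥0∞) (hf : Measurable f) :
    ∫⁻ x, f x = ∫⁻ φ in Ioo (-π) π, ∫⁻ r in Ioi (0 : ℝ), ∫⁻ θ in Ioo 0 π,
      ENNReal.ofReal r * (ENNReal.ofReal (r * sin θ) *
        f !₂[r * sin θ * cos φ, r * sin θ * sin φ, r * cos θ]) := by
  -- Cylindrical coordinates become spherical ones by a second use of polar coordinates, in the
  -- half-plane of the pairs `(z, ρ)` at fixed azimuth.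
  have key : ∀ φ : ℝ, ∫⁻ z : ℝ, ∫⁻ ρ in Ioi (0 : ℝ),
      ENNReal.ofReal ρ * f !₂[ρ * cos φ, ρ * sin φ, z] =
      ∫⁻ r in Ioi (0 : ℝ), ∫⁻ θ in Ioo 0 π, ENNReal.ofReal r * (ENNReal.ofReal (r * sin θ) *
        f !₂[r * sin θ * cos φ, r * sin θ * sin φ, r * cos θ]) := by
    intro φ
    set g : ℝ × ℝ → ℝ≥0∞ := fun q =>
      ENNReal.ofReal q.2 * f !₂[q.2 * cos φ, q.2 * sin φ, q.1] with hg
    have hgm : Measurable g := by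
      have : Measurable fun q : ℝ × ℝ => !₂[q.2 * cos φ, q.2 * sin φ, q.1] := by fun_prop
      fun_prop
    -- `ENNReal.ofReal` kills the density for `ρ ≤ 0`, so the half-plane may be replaced by the
    -- plane.
    have hfull : ∀ z : ℝ, ∫⁻ ρ in Ioi (0 : ℝ), g (z, ρ) = ∫⁻ ρ, g (z, ρ) := by
      intro z
      refine setLIntegral_eq_of_support_subset ?_
      intro ρ hρ
      by_contra h
      exact hρ (by simp [hg, ENNReal.ofReal_of_nonpos (not_lt.1 h)])
    calc _ = ∫⁻ z : ℝ, ∫⁻ ρ, g (z, ρ) := lintegral_congr fun z => hfull z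
      _ = ∫⁻ q, g q := by
        rw [Measure.volume_eq_prod, lintegral_prod _ hgm.aemeasurable]
      _ = ∫⁻ r in Ioi (0 : ℝ), ∫⁻ θ in Ioo (-π) π,
            ENNReal.ofReal r * g (polarCoord.symm (r, θ)) := by
        rw [← lintegral_comp_polarCoord_symm, polarCoord_target, Measure.volume_eq_prod,
          ← Measure.prod_restrict, lintegral_prod _ (by
            have := continuous_polarCoord_symm.measurable; simp only [smul_eq_mul]; fun_prop)]
        rfl
      _ = _ := by
        refine setLIntegral_congr_fun measurableSet_Ioi fun r hr => ?_
        simp only [hg, polarCoord_symm_apply]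
        have hsub : Ioo 0 π ⊆ Ioo (-π) π := Ioo_subset_Ioo_left (by linarith [pi_pos])
        rw [← lintegral_indicator measurableSet_Ioo, ← lintegral_indicator measurableSet_Ioo]
        refine lintegral_congr fun θ => ?_
        -- For `θ ∈ (-π, 0]` the sine is nonpositive and the truncated density vanishes.
        by_cases h1 : θ ∈ Ioo 0 π
        · rw [indicator_of_mem h1, indicator_of_mem (hsub h1)]
        · rw [indicator_of_notMem h1]
          refine indicator_apply_eq_zero.2 fun hθ => ?_
          have h0 : θ ≤ 0 := not_lt.1 fun h => h1 ⟨h, hθ.2⟩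
          have := sin_nonpos_of_nonpos_of_neg_pi_le h0 hθ.1.le
          rw [ENNReal.ofReal_of_nonpos (mul_nonpos_of_nonneg_of_nonpos (le_of_lt hr) this)]
          simp
  have hm : Measurable fun q : ℝ × ℝ × ℝ =>
      ENNReal.ofReal q.2.1 * f !₂[q.2.1 * cos q.2.2, q.2.1 * sin q.2.2, q.1] := by
    have : Measurable fun q : ℝ × ℝ × ℝ => !₂[q.2.1 * cos q.2.2, q.2.1 * sin q.2.2, q.1] := by
      fun_prop
    fun_prop
  calc ∫⁻ x, f x = ∫⁻ z : ℝ, ∫⁻ φ in Ioo (-π) π, ∫⁻ ρ in Ioi (0 : ℝ),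
        ENNReal.ofReal ρ * f !₂[ρ * cos φ, ρ * sin φ, z] := by
        rw [lintegral_euclideanSpace_three f hf]
        congr 1 with z
        rw [← lintegral_comp_polarCoord_symm, polarCoord_target, Measure.volume_eq_prod,
          ← Measure.prod_restrict]
        exact lintegral_prod_symm (fun q : ℝ × ℝ =>
          ENNReal.ofReal q.1 * f !₂[q.1 * cos q.2, q.1 * sin q.2, z])
          (hm.comp (measurable_const.prodMk measurable_id)).aemeasurable
    _ = ∫⁻ φ in Ioo (-π) π, ∫⁻ z : ℝ, ∫⁻ ρ in Ioi (0 : ℝ),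
        ENNReal.ofReal ρ * f !₂[ρ * cos φ, ρ * sin φ, z] := by
        refine lintegral_lintegral_swap (Measurable.aemeasurable ?_)
        refine Measurable.lintegral_prod_right' (f := fun q : (ℝ × ℝ) × ℝ =>
          ENNReal.ofReal q.2 * f !₂[q.2 * cos q.1.2, q.2 * sin q.1.2, q.1.1]) ?_
        exact hm.comp (f := fun q : (ℝ × ℝ) × ℝ => (q.1.1, q.2, q.1.2)) (by fun_prop)
    _ = _ := lintegral_congr fun φ => key φ

/-- The point of the sphere with polar angle `p.1` and azimuth `p.2`. -/
def sphericalPoint (p : ℝ × ℝ) : S2 :=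
  ⟨!₂[sin p.1 * cos p.2, sin p.1 * sin p.2, cos p.1], by
    rw [mem_sphere_zero_iff_norm, EuclideanSpace.norm_eq, sqrt_eq_one]
    simp only [Fin.sum_univ_three, norm_eq_abs, sq_abs, Matrix.cons_val]
    linear_combination sin p.1 ^ 2 * sin_sq_add_cos_sq p.2 + sin_sq_add_cos_sq p.1⟩

theorem continuous_sphericalPoint : Continuous sphericalPoint := by
  refine Continuous.subtype_mk ?_ _
  refine (PiLp.continuous_toLp 2 _).comp (continuous_pi fun i => ?_)
  fin_cases i <;> simp <;> fun_prop

/-- The measure `sin θ dθ` on `(0, π)`. -/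
def polarMeasure : Measure ℝ :=
  (volume.restrict (Ioo 0 π)).withDensity fun θ => ENNReal.ofReal (sin θ)

/-- The radial part of the volume of a cone; it cancels the dimension factor in `Measure.toSphere`.
-/
theorem lintegral_Ioo_sq : ∫⁻ r in Ioo (0 : ℝ) 1, ENNReal.ofReal (r ^ 2) = 3⁻¹ := by
  rw [Measure.restrict_congr_set Ioo_ae_eq_Ioc, ← ofReal_integral_eq_lintegral_ofReal
    (intervalIntegral.intervalIntegrable_pow 2).1, ← intervalIntegral.integral_of_le zero_le_one]
  · rw [integral_pow]
    rw [← ENNReal.ofReal_ofNat, ← ENNReal.ofReal_inv_of_pos (by norm_num)]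
    norm_num
  · filter_upwards with y using sq_nonneg y

/-- `Measure.toSphere` measures `s` through the volume of this cone, which is the image of a product
set under the polar homeomorphism of the punctured space. -/
theorem measurableSet_cone {s : Set S2} (hs : MeasurableSet s) :
    MeasurableSet (Ioo (0 : ℝ) 1 • ((↑) '' s) : Set (EuclideanSpace ℝ (Fin 3))) := by
  let e := homeomorphUnitSphereProd (EuclideanSpace ℝ (Fin 3))
  have he : MeasurableEmbedding (Subtype.val ∘ e.symm) :=
    (MeasurableEmbedding.subtype_coe (measurableSet_singleton _).compl).comp
      (Homeomorph.measurableEmbedding _)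
  have : (Ioo (0 : ℝ) 1 • ((↑) '' s) : Set (EuclideanSpace ℝ (Fin 3))) =
      (Subtype.val ∘ e.symm) '' (s ×ˢ Iio ⟨1, mem_Ioi.2 one_pos⟩) := by
    ext x
    simp only [mem_smul, mem_image, Function.comp, Prod.exists, mem_prod, mem_Iio]
    constructor
    · rintro ⟨r, hr, _, ⟨y, hy, rfl⟩, rfl⟩
      exact ⟨y, ⟨r, hr.1⟩, ⟨hy, hr.2⟩, rfl⟩
    · rintro ⟨y, r, ⟨hy, hr⟩, rfl⟩
      exact ⟨r, ⟨r.2, hr⟩, _, ⟨y, hy, rfl⟩, rfl⟩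
  rw [this]
  exact he.measurableSet_image.2 (hs.prod measurableSet_Iio)

theorem smul_mem_cone_iff {s : Set S2} {r : ℝ} (hr : 0 < r) (y : S2) :
    r • (y : EuclideanSpace ℝ (Fin 3)) ∈ Ioo (0 : ℝ) 1 • (((↑) : S2 → _) '' s) ↔
      r < 1 ∧ y ∈ s := by
  constructor
  · rintro ⟨r', hr', _, ⟨y', hy', rfl⟩, h⟩
    simp only at h
    have hn := congrArg norm h
    rw [norm_smul, norm_smul, norm_eq_of_mem_sphere, norm_eq_of_mem_sphere, mul_one, mul_one,
      norm_of_nonneg hr'.1.le, norm_of_nonneg hr.le] at hn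
    subst hn
    have : y' = y := Subtype.ext (smul_right_injective _ hr.ne' h)
    exact ⟨hr'.2, this ▸ hy'⟩
  · rintro ⟨h1, h2⟩
    exact ⟨r, ⟨hr, h1⟩, _, ⟨y, h2, rfl⟩, rfl⟩

/-- The surface measure is `sin θ dθ dφ` in spherical coordinates. -/
theorem surfaceMeasure_eq_map :
    surfaceMeasure =
      (polarMeasure.prod (volume.restrict (Ioo (-π) π))).map sphericalPoint := by
  have : SFinite polarMeasure := by unfold polarMeasure; infer_instance
  have hΨ := continuous_sphericalPoint.measurable
  ext s hs
  have hA := measurableSet_cone hs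
  have hpre : ∀ φ, MeasurableSet ((fun θ => (θ, φ)) ⁻¹' (sphericalPoint ⁻¹' s)) := fun φ =>
    (by fun_prop : Measurable fun θ : ℝ => (θ, φ)) (hΨ hs)
  rw [Measure.toSphere_apply' _ hs, Measure.map_apply hΨ hs,
    Measure.prod_apply_symm (hΨ hs), ← lintegral_indicator_one hA,
    lintegral_spherical _ (measurable_one.indicator hA), finrank_euclideanSpace,
    Fintype.card_fin, ← lintegral_const_mul' _ _ (by simp)]
  refine lintegral_congr fun φ => ?_
  rw [polarMeasure, withDensity_apply _ (hpre φ), ← lintegral_indicator (hpre φ)]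
  -- Membership in the cone separates into `r < 1` and a condition on the angles, so the radial
  -- integral factors out.
  have hr : ∀ r ∈ Ioi (0 : ℝ), ∫⁻ θ in Ioo 0 π,
      ENNReal.ofReal r * (ENNReal.ofReal (r * sin θ) *
        (Ioo (0 : ℝ) 1 • (((↑) : S2 → EuclideanSpace ℝ (Fin 3)) '' s)).indicator 1
          !₂[r * sin θ * cos φ, r * sin θ * sin φ, r * cos θ]) =
      (Iio (1 : ℝ)).indicator (fun r => ENNReal.ofReal (r ^ 2)) r *
        ∫⁻ θ in Ioo 0 π, ((fun θ => (θ, φ)) ⁻¹' (sphericalPoint ⁻¹' s)).indicator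
          (fun θ => ENNReal.ofReal (sin θ)) θ := by
    intro r hr
    rw [← lintegral_const_mul _ ((by fun_prop : Measurable fun θ : ℝ =>
      ENNReal.ofReal (sin θ)).indicator (hpre φ))]
    refine lintegral_congr fun θ => ?_
    have hp : (!₂[r * sin θ * cos φ, r * sin θ * sin φ, r * cos θ] : EuclideanSpace ℝ (Fin 3)) =
        r • (sphericalPoint (θ, φ) : EuclideanSpace ℝ (Fin 3)) := by
      ext i
      fin_cases i <;> simp [sphericalPoint, mul_assoc]
    classical
    have hi : (Ioo (0 : ℝ) 1 • (((↑) : S2 → EuclideanSpace ℝ (Fin 3)) '' s)).indicator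
        (1 : EuclideanSpace ℝ (Fin 3) → ℝ≥0∞)
        (r • (sphericalPoint (θ, φ) : EuclideanSpace ℝ (Fin 3))) =
        if r < 1 ∧ sphericalPoint (θ, φ) ∈ s then 1 else 0 :=
      (indicator_apply _ _ _).trans (if_congr (smul_mem_cone_iff hr _) rfl rfl)
    rw [hp, hi]
    simp only [indicator_apply, mem_preimage, mem_Iio]
    by_cases h1 : r < 1 <;> by_cases h2 : sphericalPoint (θ, φ) ∈ s <;> simp [h1, h2]
    rw [ENNReal.ofReal_mul (le_of_lt hr), ← mul_assoc, ENNReal.ofReal_pow (le_of_lt hr), sq]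
  rw [setLIntegral_congr_fun measurableSet_Ioi hr, lintegral_mul_const _
    ((by fun_prop : Measurable fun r : ℝ => ENNReal.ofReal (r ^ 2)).indicator measurableSet_Iio),
    lintegral_indicator measurableSet_Iio, Measure.restrict_restrict measurableSet_Iio,
    Iio_inter_Ioi, lintegral_Ioo_sq, ← mul_assoc]
  norm_cast
  rw [ENNReal.mul_inv_cancel (by simp) (by simp), one_mul]

end RealSphHarm

end

/-! ### Integrals of Legendre polynomials and their derivatives -/

noncomputable section

namespace RealSphHarm

open Polynomial

/-- The integral over `[-1, 1]` of a polynomial. -/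
def polyIntegral : ℝ[X] →ₗ[ℝ] ℝ where
  toFun p := ∫ x in (-1 : ℝ)..1, p.eval x
  map_add' p q := by
    simp only [eval_add]
    exact intervalIntegral.integral_add (p.continuous.intervalIntegrable _ _)
      (q.continuous.intervalIntegrable _ _)
  map_smul' c p := by simp

theorem polyIntegral_C_mul (c : ℝ) (p : ℝ[X]) :
    polyIntegral (C c * p) = c * polyIntegral p := by
  rw [← smul_eq_C_mul, map_smul, smul_eq_mul]

/-- Divisibility by `X ^ 2 - 1` removes the boundary terms at `±1`. -/
theorem polyIntegral_mul_derivative (p q : ℝ[X]) (h : (X ^ 2 - 1) ∣ p) :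
    polyIntegral (p * derivative q) = -polyIntegral (derivative p * q) := by
  have := intervalIntegral.integral_mul_deriv_eq_deriv_mul (a := -1) (b := 1)
    (fun x _ => p.hasDerivAt x) (fun x _ => q.hasDerivAt x)
    ((derivative p).continuous.intervalIntegrable _ _)
    ((derivative q).continuous.intervalIntegrable _ _)
  obtain ⟨r, rfl⟩ := h
  simpa [polyIntegral] using this

theorem derivative_X_sq_sub_one_pow_succ (m : ℕ) :
    derivative (((X : ℝ[X]) ^ 2 - 1) ^ (m + 1)) =
      2 * ((m : ℝ[X]) + 1) * X * (X ^ 2 - 1) ^ m := by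
  have hC : C (2 : ℝ) = 2 := map_ofNat C 2
  simp [derivative_pow, hC]
  ring

/-- With `u = (X² - 1)^l`, this is `(X² - 1) u' = 2 l X u` differentiated `k + 1` times. -/
theorem iterate_derivative_X_sq_sub_one_pow (l k : ℕ) :
    ((X : ℝ[X]) ^ 2 - 1) * derivative^[k + 2] ((X ^ 2 - 1) ^ l) +
        2 * ((k : ℝ[X]) + 1 - (l : ℝ[X])) * X * derivative^[k + 1] ((X ^ 2 - 1) ^ l) =
      ((k : ℝ[X]) + 1) * (2 * (l : ℝ[X]) - (k : ℝ[X])) * derivative^[k] ((X ^ 2 - 1) ^ l) := by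
  induction k with
  | zero =>
    have h1 : ((X : ℝ[X]) ^ 2 - 1) * derivative ((X ^ 2 - 1) ^ l) =
        2 * (l : ℝ[X]) * X * (X ^ 2 - 1) ^ l := by
      cases l with
      | zero => simp
      | succ l => rw [derivative_X_sq_sub_one_pow_succ]; push_cast; ring
    have h2 := congrArg derivative h1
    simp [derivative_mul] at h2
    simp
    linear_combination h2
  | succ k ih =>
    have h2 := congrArg derivative ih
    simp [derivative_mul] at h2
    simp only [← Function.iterate_succ_apply'] at h2
    push_cast
    simp only [Function.iterate_succ_apply] at h2 ⊢
    linear_combination h2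

theorem iterate_derivative_two_mul (l : ℕ) :
    derivative^[2 * l] (((X : ℝ[X]) ^ 2 - 1) ^ l) = C ((2 * l).factorial : ℝ) := by
  have hm : ((X : ℝ[X]) ^ 2 - 1).Monic := by monicity!
  have hd : (((X : ℝ[X]) ^ 2 - 1) ^ l).natDegree = 2 * l := by
    rw [hm.natDegree_pow]
    have h2 : ((X : ℝ[X]) ^ 2 - 1).natDegree = 2 := by compute_degree!
    rw [h2, mul_comm]
  have h0 : (derivative^[2 * l] (((X : ℝ[X]) ^ 2 - 1) ^ l)).natDegree ≤ 0 := by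
    have := natDegree_iterate_derivative (((X : ℝ[X]) ^ 2 - 1) ^ l) (2 * l)
    rwa [hd, Nat.sub_self] at this
  rw [eq_C_of_natDegree_le_zero h0, coeff_iterate_derivative, zero_add, Nat.descFactorial_self]
  have : (((X : ℝ[X]) ^ 2 - 1) ^ l).coeff (2 * l) = 1 := by
    rw [← hd]; exact (hm.pow l).coeff_natDegree
  rw [this, nsmul_eq_mul, mul_one]

theorem iterate_derivative_eq_zero_of_lt {l n : ℕ} (h : 2 * l < n) :
    derivative^[n] (((X : ℝ[X]) ^ 2 - 1) ^ l) = 0 := by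
  refine iterate_derivative_eq_zero (lt_of_le_of_lt ?_ h)
  compute_degree!
  omega

/-- Iterated integration by parts against Rodrigues' expression. -/
theorem polyIntegral_rodrigues_mul (l : ℕ) (q : ℝ[X]) :
    polyIntegral (derivative^[l] ((X ^ 2 - 1) ^ l) * q) =
      (-1) ^ l * polyIntegral ((X ^ 2 - 1) ^ l * derivative^[l] q) := by
  suffices h : ∀ j ≤ l, polyIntegral (derivative^[l] ((X ^ 2 - 1) ^ l) * q) =
      (-1) ^ j * polyIntegral (derivative^[l - j] ((X ^ 2 - 1) ^ l) * derivative^[j] q) by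
    simpa using h l le_rfl
  intro j
  induction j with
  | zero => simp
  | succ j ih =>
    intro hj
    -- Fewer than `l` derivatives leave a factor `X ^ 2 - 1`.
    have hdvd : ((X : ℝ[X]) ^ 2 - 1) ∣ derivative^[l - (j + 1)] ((X ^ 2 - 1) ^ l) :=
      (dvd_pow_self _ (by omega)).trans (pow_sub_dvd_iterate_derivative_pow _ l (l - (j + 1)))
    rw [ih (by omega), Function.iterate_succ_apply', polyIntegral_mul_derivative _ _ hdvd,
      ← Function.iterate_succ_apply' derivative, show (l - (j + 1)).succ = l - j by omega]
    ring

/-- Integration by parts against `X` gives the recursion `(2l + 3) I_{l+1} = -2(l + 1) I_l`. -/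
theorem polyIntegral_X_sq_sub_one_pow (l : ℕ) :
    polyIntegral ((X ^ 2 - 1) ^ l) * (2 * l + 1).factorial =
      (-1) ^ l * 2 ^ (2 * l + 1) * (l.factorial : ℝ) ^ 2 := by
  induction l with
  | zero =>
    simp [polyIntegral]
    norm_num
  | succ l ih =>
    have h := polyIntegral_mul_derivative ((X ^ 2 - 1) ^ (l + 1)) X (dvd_pow_self _ (by simp))
    have h2 : derivative (((X : ℝ[X]) ^ 2 - 1) ^ (l + 1)) * X =
        C (2 * ((l : ℝ) + 1)) * ((X ^ 2 - 1) ^ (l + 1) + (X ^ 2 - 1) ^ l) := by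
      rw [derivative_X_sq_sub_one_pow_succ]
      simp only [map_mul, map_add, map_natCast, map_one, map_ofNat]
      ring
    rw [h2, polyIntegral_C_mul, map_add, derivative_X, mul_one] at h
    rw [show 2 * (l + 1) + 1 = 2 * l + 1 + 1 + 1 by ring, Nat.factorial_succ,
      Nat.factorial_succ (2 * l + 1), Nat.factorial_succ l]
    push_cast
    linear_combination (2 * (l : ℝ) + 2) * (2 * l + 1).factorial * h -
      (2 * (l : ℝ) + 2) ^ 2 * ih

theorem polyIntegral_rodrigues_self (l : ℕ) :
    polyIntegral (derivative^[l] ((X ^ 2 - 1) ^ l) * derivative^[l] ((X ^ 2 - 1) ^ l)) *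
      (2 * l + 1) = 2 ^ (2 * l + 1) * (l.factorial : ℝ) ^ 2 := by
  rw [polyIntegral_rodrigues_mul, ← Function.iterate_add_apply, ← two_mul,
    iterate_derivative_two_mul, mul_comm _ (C _), polyIntegral_C_mul]
  have h := polyIntegral_X_sq_sub_one_pow l
  rw [Nat.factorial_succ] at h
  push_cast at h
  have h1 : ((-1 : ℝ) ^ l) * (-1) ^ l = 1 := by rw [← mul_pow]; simp
  linear_combination (-1) ^ l * h + 2 ^ (2 * l + 1) * (l.factorial : ℝ) ^ 2 * h1

theorem polyIntegral_rodrigues_of_lt {k l : ℕ} (h : k < l) :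
    polyIntegral (derivative^[l] ((X ^ 2 - 1) ^ l) * derivative^[k] ((X ^ 2 - 1) ^ k)) = 0 := by
  rw [polyIntegral_rodrigues_mul, ← Function.iterate_add_apply,
    iterate_derivative_eq_zero_of_lt (by omega)]
  simp

/-- Raising the order by one in the weighted integrals of two associated Legendre functions. -/
theorem polyIntegral_order_succ (l k m : ℕ) :
    polyIntegral ((X ^ 2 - 1) ^ (m + 1) * derivative^[l + (m + 1)] ((X ^ 2 - 1) ^ l) *
        derivative^[k + (m + 1)] ((X ^ 2 - 1) ^ k)) =
      -(((l : ℝ) + m + 1) * (l - m)) *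
        polyIntegral ((X ^ 2 - 1) ^ m * derivative^[l + m] ((X ^ 2 - 1) ^ l) *
          derivative^[k + m] ((X ^ 2 - 1) ^ k)) := by
  rw [← add_assoc, ← add_assoc, Function.iterate_succ_apply' derivative (k + m),
    polyIntegral_mul_derivative _ _ (Dvd.dvd.mul_right (dvd_pow_self _ (by simp)) _), neg_mul,
    ← polyIntegral_C_mul]
  congr 2
  -- For `k = l + m` this is the associated Legendre equation in Sturm–Liouville form: the
  -- derivative of `(X² - 1)^(m+1) u^(l+m+1)` is `(l + m + 1)(l - m) (X² - 1)^m u^(l+m)`.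
  have h := iterate_derivative_X_sq_sub_one_pow l (l + m)
  rw [derivative_mul, ← Function.iterate_succ_apply' derivative,
    derivative_X_sq_sub_one_pow_succ]
  push_cast at h
  simp only [map_mul, map_add, map_sub, map_natCast, map_one]
  linear_combination (X ^ 2 - 1) ^ m * derivative^[k + m] ((X ^ 2 - 1) ^ k) * h

/-- The factors `(l + j + 1)(l - j)` for `j < m` multiply to `(l + m)! / (l - m)!`. -/
theorem polyIntegral_order (l k m : ℕ) (hm : m ≤ l) :
    polyIntegral ((X ^ 2 - 1) ^ m * derivative^[l + m] ((X ^ 2 - 1) ^ l) *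
        derivative^[k + m] ((X ^ 2 - 1) ^ k)) * (l - m).factorial =
      (-1) ^ m * (l + m).factorial *
        polyIntegral (derivative^[l] ((X ^ 2 - 1) ^ l) * derivative^[k] ((X ^ 2 - 1) ^ k)) := by
  induction m with
  | zero => simp [mul_comm]
  | succ m ih =>
    have ih := ih (by omega)
    obtain ⟨d, rfl⟩ := Nat.exists_eq_add_of_le hm
    rw [show m + 1 + d - m = d + 1 by omega, Nat.factorial_succ] at ih
    rw [polyIntegral_order_succ, ← add_assoc (m + 1 + d) m 1, Nat.factorial_succ,
      show m + 1 + d - (m + 1) = d by omega]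
    push_cast at ih ⊢
    linear_combination (-((m : ℝ) + 1 + d + m + 1)) * ih

theorem iterate_derivative_legendre (l m : ℕ) :
    derivative^[m] (legendre l) =
      C (1 / (2 ^ l * (l.factorial : ℝ))) * derivative^[l + m] ((X ^ 2 - 1) ^ l) := by
  rw [legendre, iterate_derivative_C_mul, ← Function.iterate_add_apply, add_comm]

/-- The `L²` scalar products of the associated Legendre functions of equal order. -/
theorem polyIntegral_assocLegendre (l k m : ℕ) (hl : m ≤ l) (hk : m ≤ k) :
    polyIntegral ((1 - X ^ 2) ^ m * derivative^[m] (legendre l) * derivative^[m] (legendre k)) =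
      if l = k then 2 / (2 * l + 1) * (((l + m).factorial : ℝ) / (l - m).factorial) else 0 := by
  have hneg : ((1 - X ^ 2 : ℝ[X])) ^ m = C ((-1) ^ m) * (X ^ 2 - 1) ^ m := by
    rw [C_pow, ← mul_pow]; congr 1; simp
  have h1 : ((-1 : ℝ) ^ m) * (-1) ^ m = 1 := by rw [← mul_pow]; simp
  have h := polyIntegral_order l k m hl
  have hf : ((l - m).factorial : ℝ) ≠ 0 := by positivity
  rw [iterate_derivative_legendre, iterate_derivative_legendre, hneg,
    show ∀ a b c p q r : ℝ[X], a * p * (b * q) * (c * r) = (a * b * c) * (p * q * r) by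
      intros; ring, ← C_mul, ← C_mul, polyIntegral_C_mul, eq_div_of_mul_eq hf h]
  split_ifs with hlk
  · subst hlk
    have h0 := polyIntegral_rodrigues_self l
    rw [eq_div_of_mul_eq (by positivity) h0]
    field_simp
    linear_combination 2 ^ (2 * l + 1) * h1
  · have h0 : polyIntegral (derivative^[l] ((X ^ 2 - 1) ^ l) *
        derivative^[k] ((X ^ 2 - 1) ^ k)) = 0 := by
      rcases lt_or_gt_of_ne hlk with h | h
      · rw [mul_comm, polyIntegral_rodrigues_of_lt h]
      · exact polyIntegral_rodrigues_of_lt h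
    rw [h0]; simp

theorem degree_iterate_derivative_legendre {l m : ℕ} (h : m ≤ l) :
    (derivative^[m] (legendre l)).degree = ((l - m : ℕ) : WithBot ℕ) := by
  -- After `l - m` further derivatives the nonzero leading constant remains, which bounds the degree
  -- from below.
  have hne : derivative^[l - m] (derivative^[m] (legendre l)) ≠ 0 := by
    rw [← Function.iterate_add_apply, Nat.sub_add_cancel h, iterate_derivative_legendre,
      ← two_mul, iterate_derivative_two_mul]
    simp [Nat.factorial_ne_zero]
  refine le_antisymm ?_ ?_
  · refine degree_le_of_natDegree_le ?_
    rw [iterate_derivative_legendre]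
    refine (natDegree_C_mul_le _ _).trans ((natDegree_iterate_derivative _ _).trans ?_)
    have : (((X : ℝ[X]) ^ 2 - 1) ^ l).natDegree ≤ 2 * l := by compute_degree!; omega
    omega
  · by_contra hlt
    exact hne (iterate_derivative_eq_zero_of_degree_lt (not_le.1 hlt))

end RealSphHarm

end

/-! ### Trigonometric integrals and orthonormality -/

noncomputable section

namespace RealSphHarm

open Polynomial

theorem integral_cos_int_mul (k : ℤ) :
    ∫ φ in (-Real.pi)..Real.pi, Real.cos (k * φ) = if k = 0 then 2 * Real.pi else 0 := by
  split_ifs with h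
  · simp [h, two_mul]
  · have hk : (k : ℝ) ≠ 0 := by exact_mod_cast h
    rw [intervalIntegral.integral_comp_mul_left _ hk, integral_cos]
    simp [Real.sin_int_mul_pi]

theorem integral_sin_int_mul (k : ℤ) :
    ∫ φ in (-Real.pi)..Real.pi, Real.sin (k * φ) = 0 := by
  by_cases h : k = 0
  · simp [h]
  · have hk : (k : ℝ) ≠ 0 := by exact_mod_cast h
    rw [intervalIntegral.integral_comp_mul_left _ hk, integral_sin]
    simp

theorem integral_cos_mul_cos (m n : ℕ) :
    ∫ φ in (-Real.pi)..Real.pi, Real.cos (m * φ) * Real.cos (n * φ) =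
      if m = n then (if m = 0 then 2 * Real.pi else Real.pi) else 0 := by
  have h : ∀ φ : ℝ, Real.cos (m * φ) * Real.cos (n * φ) =
      (Real.cos (((m - n : ℤ) : ℝ) * φ) + Real.cos (((m + n : ℤ) : ℝ) * φ)) * (1 / 2) := by
    intro φ
    push_cast
    rw [sub_mul ((m : ℝ)) _ φ, add_mul ((m : ℝ)) _ φ, Real.cos_sub, Real.cos_add]
    ring
  simp_rw [h]
  rw [intervalIntegral.integral_mul_const, intervalIntegral.integral_add
    (Continuous.intervalIntegrable (by fun_prop) _ _)
    (Continuous.intervalIntegrable (by fun_prop) _ _), integral_cos_int_mul, integral_cos_int_mul]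
  by_cases hmn : m = n
  · subst hmn
    by_cases hm : m = 0
    · simp [hm]; ring
    · have : ((m : ℤ) + m) ≠ 0 := by omega
      simp [hm, this]
      ring
  · have h1 : ((m : ℤ) - n) ≠ 0 := by omega
    have h2 : ((m : ℤ) + n) ≠ 0 := by omega
    simp [hmn, h1, h2]

theorem integral_sin_mul_sin (m n : ℕ) :
    ∫ φ in (-Real.pi)..Real.pi, Real.sin (m * φ) * Real.sin (n * φ) =
      if m = n then (if m = 0 then 0 else Real.pi) else 0 := by
  have h : ∀ φ : ℝ, Real.sin (m * φ) * Real.sin (n * φ) =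
      (Real.cos (((m - n : ℤ) : ℝ) * φ) - Real.cos (((m + n : ℤ) : ℝ) * φ)) * (1 / 2) := by
    intro φ
    push_cast
    rw [sub_mul ((m : ℝ)) _ φ, add_mul ((m : ℝ)) _ φ, Real.cos_sub, Real.cos_add]
    ring
  simp_rw [h]
  rw [intervalIntegral.integral_mul_const, intervalIntegral.integral_sub
    (Continuous.intervalIntegrable (by fun_prop) _ _)
    (Continuous.intervalIntegrable (by fun_prop) _ _), integral_cos_int_mul, integral_cos_int_mul]
  by_cases hmn : m = n
  · subst hmn
    by_cases hm : m = 0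
    · simp [hm]
    · have : ((m : ℤ) + m) ≠ 0 := by omega
      simp [hm, this]
      ring
  · have h1 : ((m : ℤ) - n) ≠ 0 := by omega
    have h2 : ((m : ℤ) + n) ≠ 0 := by omega
    simp [hmn, h1, h2]

theorem integral_sin_mul_cos (m n : ℕ) :
    ∫ φ in (-Real.pi)..Real.pi, Real.sin (m * φ) * Real.cos (n * φ) = 0 := by
  have h : ∀ φ : ℝ, Real.sin (m * φ) * Real.cos (n * φ) =
      (Real.sin (((m - n : ℤ) : ℝ) * φ) + Real.sin (((m + n : ℤ) : ℝ) * φ)) * (1 / 2) := by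
    intro φ
    push_cast
    rw [sub_mul ((m : ℝ)) _ φ, add_mul ((m : ℝ)) _ φ, Real.sin_sub, Real.sin_add]
    ring
  simp_rw [h]
  rw [intervalIntegral.integral_mul_const, intervalIntegral.integral_add
    (Continuous.intervalIntegrable (by fun_prop) _ _)
    (Continuous.intervalIntegrable (by fun_prop) _ _), integral_sin_int_mul, integral_sin_int_mul]
  simp

theorem integral_cos_mul_sin (m n : ℕ) :
    ∫ φ in (-Real.pi)..Real.pi, Real.cos (m * φ) * Real.sin (n * φ) = 0 := by
  simp_rw [mul_comm (Real.cos _)]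
  exact integral_sin_mul_cos n m

theorem integral_polarMeasure (g : ℝ → ℝ) :
    ∫ θ, g θ ∂polarMeasure = ∫ θ in (0 : ℝ)..Real.pi, Real.sin θ * g θ := by
  rw [polarMeasure, integral_withDensity_eq_integral_toReal_smul (by fun_prop) (by simp),
    intervalIntegral.integral_of_le Real.pi_pos.le,
    Measure.restrict_congr_set Ioo_ae_eq_Ioc]
  refine setIntegral_congr_fun measurableSet_Ioc fun θ hθ => ?_
  simp only [smul_eq_mul]
  rw [ENNReal.toReal_ofReal (Real.sin_nonneg_of_nonneg_of_le_pi hθ.1.le hθ.2)]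

theorem integral_polarMeasure_eval_cos (p : ℝ[X]) :
    ∫ θ, p.eval (Real.cos θ) ∂polarMeasure = polyIntegral p := by
  rw [integral_polarMeasure]
  have h := intervalIntegral.integral_comp_mul_deriv (a := 0) (b := Real.pi) (f := Real.cos)
    (f' := fun θ => -Real.sin θ) (g := fun x => p.eval x)
    (fun θ _ => Real.hasDerivAt_cos θ) (by fun_prop) p.continuous
  rw [Real.cos_zero, Real.cos_pi, intervalIntegral.integral_symm (-1) 1] at h
  simp only [Function.comp, mul_neg, intervalIntegral.integral_neg, neg_inj] at h
  simpa only [mul_comm (Real.sin _), polyIntegral, LinearMap.coe_mk, AddHom.coe_mk] using h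

namespace Index

/-- The degree `l`. -/
def degree : Index → ℕ
  | zonal l => l
  | cosine l _ _ _ => l
  | sine l _ _ _ => l

/-- The order `m`. -/
def order : Index → ℕ
  | zonal _ => 0
  | cosine _ m _ _ => m
  | sine _ m _ _ => m

/-- The trigonometric factor. -/
def trig : Index → ℝ → ℝ
  | zonal _, _ => 1
  | cosine _ m _ _, φ => Real.cos (m * φ)
  | sine _ m _ _, φ => Real.sin (m * φ)

/-- The square of the factor in front of `normConst`. -/
def weight : Index → ℝ
  | zonal _ => 1
  | cosine _ _ _ _ => 2
  | sine _ _ _ _ => 2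

theorem order_le_degree (i : Index) : i.order ≤ i.degree := by
  cases i <;> simp [order, degree, *]

theorem integral_trig_mul_self (i : Index) :
    ∫ φ in (-Real.pi)..Real.pi, i.trig φ * i.trig φ = 2 * Real.pi / i.weight := by
  rcases i with l | ⟨l, m, hm, hml⟩ | ⟨l, m, hm, hml⟩
  · simp [trig, weight, two_mul]
  · simp [trig, weight, integral_cos_mul_cos, show m ≠ 0 by omega]
  · simp [trig, weight, integral_sin_mul_sin, show m ≠ 0 by omega]

/-- The hypothesis `h` excludes equal order with distinct degree, where the trigonometric factors
may coincide; there the polar integral vanishes instead. -/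
theorem integral_trig_mul_trig {i j : Index} (hij : i ≠ j)
    (h : i.degree = j.degree ∨ i.order ≠ j.order) :
    ∫ φ in (-Real.pi)..Real.pi, i.trig φ * j.trig φ = 0 := by
  rcases i with l | ⟨l, m, hm, hml⟩ | ⟨l, m, hm, hml⟩ <;>
    rcases j with k | ⟨k, n, hn, hnk⟩ | ⟨k, n, hn, hnk⟩
  · simp_all [degree, order]
  · simpa [trig, show ¬ 0 = n by omega] using integral_cos_mul_cos 0 n
  · simpa [trig] using integral_cos_mul_sin 0 n
  · simp [trig, show ¬ m = 0 by omega]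
  · have : m ≠ n := by rintro rfl; simp_all [degree, order]
    simpa [trig, this] using integral_cos_mul_cos m n
  · simpa [trig] using integral_cos_mul_sin m n
  · simpa [trig] using integral_sin_mul_cos m 0
  · simpa [trig] using integral_sin_mul_cos m n
  · have : m ≠ n := by rintro rfl; simp_all [degree, order]
    simpa [trig, this] using integral_sin_mul_sin m n

end Index

/-- The complex number `x + iy` of a point `(x, y, z)` of the sphere. -/
def planar : C(S2, ℂ) where
  toFun Ω := ⟨Ω.1 0, Ω.1 1⟩
  continuous_toFun := by
    have : (fun Ω : S2 => (⟨Ω.1 0, Ω.1 1⟩ : ℂ)) =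
        fun Ω : S2 => (Ω.1 0 : ℂ) + (Ω.1 1 : ℂ) * Complex.I := by
      funext Ω; exact Complex.mk_eq_add_mul_I _ _
    rw [this]
    fun_prop

/-- `height` as a continuous function. -/
def heightMap : C(S2, ℝ) where
  toFun := height
  continuous_toFun := by unfold height; fun_prop

/-- `Re (x + iy)^m`. -/
def planarRe (m : ℕ) : C(S2, ℝ) where
  toFun Ω := (planar Ω ^ m).re
  continuous_toFun := by fun_prop

/-- `Im (x + iy)^m`. -/
def planarIm (m : ℕ) : C(S2, ℝ) where
  toFun Ω := (planar Ω ^ m).im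
  continuous_toFun := by fun_prop

/-- The sectorial factor `Re (x + iy)^m` or `Im (x + iy)^m`. -/
def sectorial : Index → C(S2, ℝ)
  | .zonal _ => planarRe 0
  | .cosine _ m _ _ => planarRe m
  | .sine _ m _ _ => planarIm m

/-- The numerical factor of a real spherical harmonic. -/
def coeffHarmonic (ε : ℤˣ) (i : Index) : ℝ :=
  √i.weight * normConst i.degree i.order * ((ε : ℤ) : ℝ) ^ i.order

/-- The real spherical harmonics as continuous functions on the sphere. -/
def harmonic (ε : ℤˣ) (i : Index) : C(S2, ℝ) :=
  coeffHarmonic ε i • (aeval heightMap (derivative^[i.order] (legendre i.degree)) * sectorial i)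

theorem polar_pow (s φ : ℝ) (m : ℕ) :
    (⟨s * Real.cos φ, s * Real.sin φ⟩ : ℂ) ^ m =
      ⟨s ^ m * Real.cos (m * φ), s ^ m * Real.sin (m * φ)⟩ := by
  have h : ∀ a b c : ℝ, (⟨a * b, a * c⟩ : ℂ) = a * (b + c * Complex.I) := by
    intro a b c
    apply Complex.ext <;> simp
  rw [h, h, mul_pow, Complex.ofReal_cos, Complex.ofReal_sin, Complex.cos_add_sin_mul_I_pow]
  push_cast
  rfl

/-- De Moivre's formula for `x + iy = s e^{iφ}`. It absorbs the square root and the azimuth into a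
polynomial in `x` and `y`, so the harmonics are continuous even where the azimuth is not. -/
theorem sectorial_apply (i : Index) {Ω : S2} {s φ : ℝ} (hx : Ω.1 0 = s * Real.cos φ)
    (hy : Ω.1 1 = s * Real.sin φ) : sectorial i Ω = s ^ i.order * i.trig φ := by
  have h : planar Ω = ⟨s * Real.cos φ, s * Real.sin φ⟩ := by simp [planar, hx, hy]
  cases i <;> simp [sectorial, planarRe, planarIm, h, polar_pow, Index.order, Index.trig]

theorem aeval_heightMap_apply (p : ℝ[X]) (Ω : S2) :
    aeval heightMap p Ω = p.eval (height Ω) := by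
  have := aeval_algHom_apply (ContinuousMap.evalAlgHom ℝ ℝ Ω) heightMap p
  rw [← Polynomial.coe_aeval_eq_eval]
  exact this.symm

theorem harmonic_apply (ε : ℤˣ) (i : Index) (Ω : S2) :
    harmonic ε i Ω = Phi ε i (height Ω) (azimuth Ω) := by
  obtain ⟨-, -, h⟩ := spherical_coordinates Ω
  have hx : Ω.1 0 = √(1 - height Ω ^ 2) * Real.cos (azimuth Ω) := by
    simpa using congrArg (fun v : EuclideanSpace ℝ (Fin 3) => v 0) h
  have hy : Ω.1 1 = √(1 - height Ω ^ 2) * Real.sin (azimuth Ω) := by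
    simpa using congrArg (fun v : EuclideanSpace ℝ (Fin 3) => v 1) h
  simp only [harmonic, ContinuousMap.smul_apply, ContinuousMap.mul_apply, smul_eq_mul,
    sectorial_apply i hx hy, aeval_heightMap_apply]
  cases i <;> simp [coeffHarmonic, Phi, assocLegendre, Index.order, Index.degree, Index.trig,
    Index.weight] <;> ring

theorem integral_surfaceMeasure (f : C(S2, ℝ)) :
    ∫ Ω, f Ω ∂surfaceMeasure = ∫ p, f (sphericalPoint p)
      ∂(polarMeasure.prod (volume.restrict (Set.Ioo (-Real.pi) Real.pi))) := by
  rw [surfaceMeasure_eq_map, integral_map continuous_sphericalPoint.measurable.aemeasurable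
    f.continuous.aestronglyMeasurable]

theorem harmonic_sphericalPoint (ε : ℤˣ) (i : Index) (p : ℝ × ℝ) :
    harmonic ε i (sphericalPoint p) = coeffHarmonic ε i *
      ((derivative^[i.order] (legendre i.degree)).eval (Real.cos p.1) *
        (Real.sin p.1 ^ i.order * i.trig p.2)) := by
  simp only [harmonic, ContinuousMap.smul_apply, ContinuousMap.mul_apply, smul_eq_mul,
    aeval_heightMap_apply]
  rw [sectorial_apply i (s := Real.sin p.1) (φ := p.2) (by simp [sphericalPoint])
    (by simp [sphericalPoint])]
  simp [height, sphericalPoint]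

theorem integral_harmonic_mul_harmonic (ε : ℤˣ) (i j : Index) :
    ∫ Ω, harmonic ε i Ω * harmonic ε j Ω ∂surfaceMeasure =
      coeffHarmonic ε i * coeffHarmonic ε j *
        (∫ θ, (derivative^[i.order] (legendre i.degree)).eval (Real.cos θ) *
          (derivative^[j.order] (legendre j.degree)).eval (Real.cos θ) *
          Real.sin θ ^ (i.order + j.order) ∂polarMeasure) *
        ∫ φ in (-Real.pi)..Real.pi, i.trig φ * j.trig φ := by
  have : SFinite polarMeasure := by unfold polarMeasure; infer_instance
  have h := integral_surfaceMeasure (harmonic ε i * harmonic ε j)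
  simp only [ContinuousMap.mul_apply, harmonic_sphericalPoint] at h
  rw [h, intervalIntegral.integral_of_le (by linarith [Real.pi_pos]),
    ← Measure.restrict_congr_set Ioo_ae_eq_Ioc, mul_assoc, ← integral_prod_mul,
    ← integral_const_mul]
  refine integral_congr_ae (Filter.Eventually.of_forall fun p => ?_)
  simp only
  ring

/-- Equal orders make the exponent of the sine even, so the integrand is a polynomial in `cos θ`. -/
theorem integral_harmonic_order_eq {i j : Index} (h : i.order = j.order) :
    ∫ θ, (derivative^[i.order] (legendre i.degree)).eval (Real.cos θ) *
        (derivative^[j.order] (legendre j.degree)).eval (Real.cos θ) *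
        Real.sin θ ^ (i.order + j.order) ∂polarMeasure =
      if i.degree = j.degree then 2 / (2 * (i.degree : ℝ) + 1) *
        (((i.degree + i.order).factorial : ℝ) / (i.degree - i.order).factorial) else 0 := by
  rw [← polyIntegral_assocLegendre _ _ _ i.order_le_degree (h ▸ j.order_le_degree),
    ← integral_polarMeasure_eval_cos]
  congr 1 with θ
  simp only [← h, eval_mul, eval_pow, eval_sub, eval_one, eval_X, ← Real.sin_sq]
  ring

theorem coeffHarmonic_sq (ε : ℤˣ) (i : Index) :
    coeffHarmonic ε i * coeffHarmonic ε i = i.weight * ((2 * (i.degree : ℝ) + 1) / (4 * Real.pi) *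
      (((i.degree - i.order).factorial : ℝ) / (i.degree + i.order).factorial)) := by
  have hw : 0 ≤ i.weight := by cases i <;> simp [Index.weight]
  have hε : (((ε : ℤ) : ℝ) ^ i.order) ^ 2 = 1 := by
    rcases Int.units_eq_one_or ε with rfl | rfl <;> simp [← pow_mul, mul_comm _ 2]
  have hN := Real.sq_sqrt (show 0 ≤ (2 * (i.degree : ℝ) + 1) / (4 * Real.pi) *
    (((i.degree - i.order).factorial : ℝ) / (i.degree + i.order).factorial) by positivity)
  rw [← sq, coeffHarmonic, mul_pow, mul_pow, hε, Real.sq_sqrt hw, normConst, hN, mul_one]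

theorem integral_harmonic (ε : ℤˣ) (i j : Index) [Decidable (i = j)] :
    ∫ Ω, harmonic ε i Ω * harmonic ε j Ω ∂surfaceMeasure = if i = j then 1 else 0 := by
  rw [integral_harmonic_mul_harmonic]
  split_ifs with hij
  · subst hij
    rw [coeffHarmonic_sq, integral_harmonic_order_eq rfl, if_pos rfl, i.integral_trig_mul_self]
    have hw : i.weight ≠ 0 := by cases i <;> simp [Index.weight]
    have := Real.pi_ne_zero
    field_simp
    norm_num
  · by_cases h : i.degree = j.degree ∨ i.order ≠ j.order
    · rw [Index.integral_trig_mul_trig hij h, mul_zero]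
    · push Not at h
      rw [integral_harmonic_order_eq h.2, if_neg h.1, mul_zero, zero_mul]

end RealSphHarm

end

/-! ### Density of the span -/

noncomputable section

namespace RealSphHarm

open Polynomial

/-- The `j`-th member has degree exactly `j`. -/
theorem span_iterate_derivative_legendre (m : ℕ) :
    Submodule.span ℝ (Set.range fun j => derivative^[m] (legendre (m + j))) = ⊤ := by
  let S : Polynomial.Sequence ℝ :=
    ⟨fun j => derivative^[m] (legendre (m + j)), fun j => by
      rw [degree_iterate_derivative_legendre (Nat.le_add_right m j), Nat.add_sub_cancel_left]⟩
  exact S.span fun i => (leadingCoeff_ne_zero.2 (S.ne_zero i)).isUnit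

theorem coeffHarmonic_ne_zero (ε : ℤˣ) (i : Index) : coeffHarmonic ε i ≠ 0 := by
  have hw : 0 < i.weight := by cases i <;> simp [Index.weight]
  have := coeffHarmonic_sq ε i
  refine mul_self_ne_zero.1 (this ▸ ne_of_gt ?_)
  positivity

/-- The linear span of the real spherical harmonics in `C(𝕊²)`. -/
def harmonicSpan (ε : ℤˣ) : Submodule ℝ C(S2, ℝ) :=
  Submodule.span ℝ (Set.range (harmonic ε))

theorem aeval_mul_sectorial_mem (ε : ℤˣ) (i : Index) :
    aeval heightMap (derivative^[i.order] (legendre i.degree)) * sectorial i ∈ harmonicSpan ε := by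
  have h : harmonic ε i ∈ harmonicSpan ε := Submodule.subset_span ⟨i, rfl⟩
  have := (harmonicSpan ε).smul_mem (coeffHarmonic ε i)⁻¹ h
  rwa [harmonic, smul_smul, inv_mul_cancel₀ (coeffHarmonic_ne_zero ε i), one_smul] at this

theorem aeval_mul_mem_of_forall (ε : ℤˣ) (m : ℕ) (f : C(S2, ℝ))
    (h : ∀ j, aeval heightMap (derivative^[m] (legendre (m + j))) * f ∈ harmonicSpan ε)
    (p : ℝ[X]) : aeval heightMap p * f ∈ harmonicSpan ε := by
  have hp : p ∈ Submodule.span ℝ (Set.range fun j => derivative^[m] (legendre (m + j))) := by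
    rw [span_iterate_derivative_legendre]; trivial
  induction hp using Submodule.span_induction with
  | mem p hp => obtain ⟨j, rfl⟩ := hp; exact h j
  | zero => simp
  | add p q _ _ hp hq => rw [map_add, add_mul]; exact add_mem hp hq
  | smul c p _ hp => rw [map_smul, smul_mul_assoc]; exact Submodule.smul_mem _ c hp

theorem aeval_mul_planarRe_mem (ε : ℤˣ) (m : ℕ) (p : ℝ[X]) :
    aeval heightMap p * planarRe m ∈ harmonicSpan ε := by
  refine aeval_mul_mem_of_forall ε m _ (fun j => ?_) p
  rcases Nat.eq_zero_or_pos m with rfl | hm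
  · exact aeval_mul_sectorial_mem ε (.zonal (0 + j))
  · exact aeval_mul_sectorial_mem ε (.cosine (m + j) m hm (Nat.le_add_right m j))

theorem planarIm_zero : planarIm 0 = 0 := by ext; simp [planarIm]

theorem aeval_mul_planarIm_mem (ε : ℤˣ) (m : ℕ) (p : ℝ[X]) :
    aeval heightMap p * planarIm m ∈ harmonicSpan ε := by
  rcases Nat.eq_zero_or_pos m with rfl | hm
  · simp [planarIm_zero]
  · refine aeval_mul_mem_of_forall ε m _ (fun j => ?_) p
    exact aeval_mul_sectorial_mem ε (.sine (m + j) m hm (Nat.le_add_right m j))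

theorem planar_normSq (Ω : S2) :
    (planar Ω).re * (planar Ω).re + (planar Ω).im * (planar Ω).im = 1 - height Ω ^ 2 := by
  have h1 : ‖Ω.1‖ = 1 := by simp
  rw [EuclideanSpace.norm_eq, Real.sqrt_eq_one] at h1
  simp [Fin.sum_univ_three] at h1
  simp only [planar, ContinuousMap.coe_mk, height]
  linarith

theorem heightMap_apply (Ω : S2) : heightMap Ω = height Ω := rfl

/-- Real part of `(w + w̄) w^(m+1) = w^(m+2) + |w|² w^m`, where `w = x + iy` and `|w|² = 1 - z²`.
The next three identities come likewise from `w ± w̄`. -/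
theorem planarRe_one_mul_planarRe (m : ℕ) :
    planarRe 1 * planarRe (m + 1) =
      (1 / 2 : ℝ) • (planarRe (m + 2) + aeval heightMap ((1 : ℝ[X]) - X ^ 2) * planarRe m) := by
  ext Ω
  have h := planar_normSq Ω
  simp [planarRe, pow_succ, heightMap_apply]
  linear_combination (1 / 2) * (planar Ω ^ m).re * h

theorem planarIm_one_mul_planarIm (m : ℕ) :
    planarIm 1 * planarIm (m + 1) =
      (1 / 2 : ℝ) • (aeval heightMap ((1 : ℝ[X]) - X ^ 2) * planarRe m - planarRe (m + 2)) := by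
  ext Ω
  have h := planar_normSq Ω
  simp [planarRe, planarIm, pow_succ, heightMap_apply]
  linear_combination (1 / 2) * (planar Ω ^ m).re * h

theorem planarRe_one_mul_planarIm (m : ℕ) :
    planarRe 1 * planarIm (m + 1) =
      (1 / 2 : ℝ) • (planarIm (m + 2) + aeval heightMap ((1 : ℝ[X]) - X ^ 2) * planarIm m) := by
  ext Ω
  have h := planar_normSq Ω
  simp [planarRe, planarIm, pow_succ, heightMap_apply]
  linear_combination (1 / 2) * (planar Ω ^ m).im * h

theorem planarIm_one_mul_planarRe (m : ℕ) :
    planarIm 1 * planarRe (m + 1) =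
      (1 / 2 : ℝ) • (planarIm (m + 2) - aeval heightMap ((1 : ℝ[X]) - X ^ 2) * planarIm m) := by
  ext Ω
  have h := planar_normSq Ω
  simp [planarRe, planarIm, pow_succ, heightMap_apply]
  linear_combination (-(1 / 2)) * (planar Ω ^ m).im * h

theorem planarRe_zero : planarRe 0 = 1 := by ext; simp [planarRe]

theorem planarRe_one_mul_mem (ε : ℤˣ) (i : Index) (p : ℝ[X]) :
    planarRe 1 * (aeval heightMap p * sectorial i) ∈ harmonicSpan ε := by
  have key : ∀ f g : C(S2, ℝ), ∀ (c : ℝ) (q : ℝ[X]),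
      aeval heightMap p * (c • (f + aeval heightMap q * g)) =
        c • (aeval heightMap p * f + aeval heightMap (p * q) * g) := by
    intro f g c q
    rw [map_mul, mul_smul_comm, mul_add, mul_assoc]
  rw [mul_left_comm]
  rcases i with l | ⟨l, m, hm, hml⟩ | ⟨l, m, hm, hml⟩
  · rw [sectorial, planarRe_zero, mul_one]
    exact aeval_mul_planarRe_mem ε 1 p
  · obtain ⟨m, rfl⟩ := Nat.exists_eq_add_of_le' hm
    rw [sectorial, planarRe_one_mul_planarRe, key]
    exact Submodule.smul_mem _ _ (add_mem (aeval_mul_planarRe_mem _ _ _)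
      (aeval_mul_planarRe_mem _ _ _))
  · obtain ⟨m, rfl⟩ := Nat.exists_eq_add_of_le' hm
    rw [sectorial, planarRe_one_mul_planarIm, key]
    exact Submodule.smul_mem _ _ (add_mem (aeval_mul_planarIm_mem _ _ _)
      (aeval_mul_planarIm_mem _ _ _))

theorem planarIm_one_mul_mem (ε : ℤˣ) (i : Index) (p : ℝ[X]) :
    planarIm 1 * (aeval heightMap p * sectorial i) ∈ harmonicSpan ε := by
  rw [mul_left_comm]
  rcases i with l | ⟨l, m, hm, hml⟩ | ⟨l, m, hm, hml⟩
  · rw [sectorial, planarRe_zero, mul_one]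
    exact aeval_mul_planarIm_mem ε 1 p
  · obtain ⟨m, rfl⟩ := Nat.exists_eq_add_of_le' hm
    rw [sectorial, planarIm_one_mul_planarRe, mul_smul_comm, mul_sub, ← mul_assoc, ← map_mul]
    exact Submodule.smul_mem _ _ (sub_mem (aeval_mul_planarIm_mem _ _ _)
      (aeval_mul_planarIm_mem _ _ _))
  · obtain ⟨m, rfl⟩ := Nat.exists_eq_add_of_le' hm
    rw [sectorial, planarIm_one_mul_planarIm, mul_smul_comm, mul_sub, ← mul_assoc, ← map_mul]
    exact Submodule.smul_mem _ _ (sub_mem (aeval_mul_planarRe_mem _ _ _)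
      (aeval_mul_planarRe_mem _ _ _))

theorem heightMap_mul_mem (ε : ℤˣ) (i : Index) (p : ℝ[X]) :
    heightMap * (aeval heightMap p * sectorial i) ∈ harmonicSpan ε := by
  have h : heightMap * (aeval heightMap p * sectorial i) =
      aeval heightMap (X * p) * sectorial i := by
    rw [map_mul, aeval_X, mul_assoc]
  rw [h]
  cases i
  · exact aeval_mul_planarRe_mem _ _ _
  · exact aeval_mul_planarRe_mem _ _ _
  · exact aeval_mul_planarIm_mem _ _ _

theorem mul_mem_harmonicSpan (ε : ℤˣ) {g : C(S2, ℝ)}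
    (hg : ∀ (i : Index) (p : ℝ[X]), g * (aeval heightMap p * sectorial i) ∈ harmonicSpan ε)
    {f : C(S2, ℝ)} (hf : f ∈ harmonicSpan ε) : g * f ∈ harmonicSpan ε := by
  induction hf using Submodule.span_induction with
  | mem f hf =>
    obtain ⟨i, rfl⟩ := hf
    rw [harmonic, mul_smul_comm]
    exact Submodule.smul_mem _ _ (hg i _)
  | zero => simp
  | add f₁ f₂ _ _ h₁ h₂ => rw [mul_add]; exact add_mem h₁ h₂
  | smul c f _ h => rw [mul_smul_comm]; exact Submodule.smul_mem _ c h

/-- The algebra of polynomial functions on the sphere. -/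
def polyAlgebra : Subalgebra ℝ C(S2, ℝ) :=
  Algebra.adjoin ℝ {planarRe 1, planarIm 1, heightMap}

/-- Multipliers preserving the span form a subalgebra, so the three coordinates suffice. -/
theorem polyAlgebra_mul_mem (ε : ℤˣ) {g : C(S2, ℝ)} (hg : g ∈ polyAlgebra) :
    ∀ f ∈ harmonicSpan ε, g * f ∈ harmonicSpan ε := by
  induction hg using Algebra.adjoin_induction with
  | mem g hg =>
    intro f hf
    rcases hg with rfl | rfl | rfl
    · exact mul_mem_harmonicSpan ε (planarRe_one_mul_mem ε) hf
    · exact mul_mem_harmonicSpan ε (planarIm_one_mul_mem ε) hf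
    · exact mul_mem_harmonicSpan ε (heightMap_mul_mem ε) hf
  | algebraMap r =>
    intro f hf
    rw [← Algebra.smul_def]
    exact Submodule.smul_mem _ r hf
  | add g₁ g₂ _ _ h₁ h₂ =>
    intro f hf
    rw [add_mul]
    exact add_mem (h₁ f hf) (h₂ f hf)
  | mul g₁ g₂ _ _ h₁ h₂ =>
    intro f hf
    rw [mul_assoc]
    exact h₁ _ (h₂ f hf)

theorem polyAlgebra_le_harmonicSpan (ε : ℤˣ) :
    Subalgebra.toSubmodule polyAlgebra ≤ harmonicSpan ε := by
  intro g hg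
  have h1 : (1 : C(S2, ℝ)) ∈ harmonicSpan ε := by
    have := aeval_mul_planarRe_mem ε 0 1
    rwa [planarRe_zero, map_one, mul_one] at this
  simpa using polyAlgebra_mul_mem ε hg 1 h1

theorem polyAlgebra_separatesPoints : polyAlgebra.SeparatesPoints := by
  intro Ω Ω' hne
  by_contra! h
  have h1 : ∀ g ∈ ({planarRe 1, planarIm 1, heightMap} : Set C(S2, ℝ)), g Ω = g Ω' := fun g hg =>
    h g ⟨g, Algebra.subset_adjoin hg, rfl⟩
  refine hne (Subtype.ext (PiLp.ext fun i => ?_))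
  fin_cases i
  · simpa [planarRe, planar] using h1 (planarRe 1) (by simp)
  · simpa [planarIm, planar] using h1 (planarIm 1) (by simp)
  · simpa [heightMap, height] using h1 heightMap (by simp)

theorem harmonicSpan_topologicalClosure (ε : ℤˣ) : (harmonicSpan ε).topologicalClosure = ⊤ := by
  refine top_unique fun f _ => ?_
  have h := ContinuousMap.subalgebra_topologicalClosure_eq_top_of_separatesPoints polyAlgebra
    polyAlgebra_separatesPoints
  have hf : f ∈ polyAlgebra.topologicalClosure := by rw [h]; trivial
  exact closure_mono (polyAlgebra_le_harmonicSpan ε) hf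

/-- The real spherical harmonics as elements of `L²(𝕊²)`. -/
def harmonicLp (ε : ℤˣ) (i : Index) : Lp ℝ 2 surfaceMeasure :=
  ContinuousMap.toLp 2 surfaceMeasure ℝ (harmonic ε i)

theorem orthonormal_harmonicLp (ε : ℤˣ) : Orthonormal ℝ (harmonicLp ε) := by
  classical
  rw [orthonormal_iff_ite]
  intro i j
  rw [harmonicLp, harmonicLp, ContinuousMap.inner_toLp, ← integral_harmonic ε i j]
  simp only [conj_trivial, mul_comm]

/-- The map from `C(𝕊²)` to `L²` is continuous with dense range, so it carries a uniformly dense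
subspace to a dense one. -/
theorem span_harmonicLp (ε : ℤˣ) :
    (Submodule.span ℝ (Set.range (harmonicLp ε))).topologicalClosure = ⊤ := by
  have h := (ContinuousMap.toLp_denseRange ℝ surfaceMeasure ℝ
    (p := 2) (by simp)).topologicalClosure_map_submodule (harmonicSpan_topologicalClosure ε)
  rwa [harmonicSpan, Submodule.map_span, ← Set.range_comp] at h

end RealSphHarm

end

/-- For either sign convention of the associated Legendre functions, the real spherical harmonics
are (the members of) an orthonormal basis of the real Hilbert space `L²(𝕊²)`. -/
theorem theoremA1 (ε : ℤˣ) :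
    ∃ b : HilbertBasis RealSphHarm.Index ℝ (Lp ℝ 2 RealSphHarm.surfaceMeasure),
      ∀ i : RealSphHarm.Index,
        b i =ᵐ[RealSphHarm.surfaceMeasure]
          fun Ω => RealSphHarm.Phi ε i (RealSphHarm.height Ω) (RealSphHarm.azimuth Ω) := by
  refine ⟨HilbertBasis.mk (RealSphHarm.orthonormal_harmonicLp ε)
    (RealSphHarm.span_harmonicLp ε).ge, fun i => ?_⟩
  rw [HilbertBasis.coe_mk]
  refine (ContinuousMap.coeFn_toLp RealSphHarm.surfaceMeasure
    (RealSphHarm.harmonic ε i)).trans (Filter.Eventually.of_forall fun Ω => ?_)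
  exact RealSphHarm.harmonic_apply ε i Ω
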